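/- Let $(S,\Sigma,\lambda)$ and $(Y,\mu)$ be $\sigma$-finite measure spaces and let $B:Y\to\Sigma$ be a core map, that is: (I) the range of $B$ is totally ordered by inclusion; (II) for each $E\in\Sigma$, $y\mapsto\lambda(E\cap B(y))$ is $\mu$-measurable; (III) $\bigcup_{y\in Y}B(y)=\bigcup_{y\in Y_0}B(y)$ for some countable $Y_0\subseteq Y$; (IV) $\lambda(B(y))<\infty$ for all $y\in Y$. Let $b=(\lambda\circ B)^*$ be the non-increasing rearrangement of $y\mapsto\lambda(B(y))$ with respect to $\mu$, that is, for $x>0$, $b(x)=\sup\{t>0: x<\mu\{y\in Y:\lambda(B(y))>t\}\}$, with $\sup\emptyset=0$. Suppose $b(t)\to0$ as $t\to\infty$. Let $L^1,L^\infty$ be the spaces of complex-valued functions for Lebesgue measure on $(0,\infty)$ and let $L^1_\mu,L^\infty_\mu$ be those for $(Y,\mu)$. For $f\in L^1+L^\infty$ put $H_bf(x)=\int_0^{b(x)}f$ for $x>0$ and $J_Bf(y)=\int_0^{\lambda(B(y))}f$ for $y\in Y$. Then there is a linear map $\Phi:L^1+L^\infty\to L^1_\mu+L^\infty_\mu$ that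 is positive (it maps non-negative functions to non-negative functions) and admissible of norm at most one (its restrictions $L^1\to L^1_\mu$ and $L^\infty\to L^\infty_\mu$ are bounded, each with norm at most one) such that $J_B=\Phi H_b$ on $L^1+L^\infty$, in the following sense: for every $f\in L^1+L^\infty$, (i) if $H_bf\in L^1+L^\infty$, then $\Phi(H_bf)=J_Bf$ $\mu$-almost everywhere; (ii) in every case the truncations $h_n=H_bf\cdot\mathbf 1_{\{|H_bf|\le n\}}$, $n=0,1,2,\dots$, belong to $L^\infty$ and $\Phi(h_n)\to J_Bf$ $\mu$-almost everywhere, that is, $\Phi H_bf=J_Bf$ when $\Phi$ is extended by truncation. -/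

import Mathlib

open MeasureTheory Filter Topology Set
open scoped ENNReal

/-- `B : Y → Σ` is a core map from `(Y, μ)` to `(S, Σ, lam)`. As usual, `μ`-measurability of a
function means that it agrees `μ`-a.e. with a measurable function. -/
structure IsCoreMap {S Y : Type*} [MeasurableSpace S] [MeasurableSpace Y]
    (lam : Measure S) (μ : Measure Y) (B : Y → Set S) : Prop where
  measurableSet (y : Y) : MeasurableSet (B y)
  totallyOrdered (y z : Y) : B y ⊆ B z ∨ B z ⊆ B y
  aemeasurable (E : Set S) (hE : MeasurableSet E) : AEMeasurable (fun y => lam (E ∩ B y)) μ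
  sigmaBounded : ∃ Y₀ : Set Y, Y₀.Countable ∧ ⋃ y, B y = ⋃ y ∈ Y₀, B y
  finite (y : Y) : lam (B y) < ∞

/-- The distribution function `t ↦ μ {y | F y > t}`, `t > 0`, of a `[0, ∞]`-valued function. -/
def distributionFunction {Y : Type*} [MeasurableSpace Y] (μ : Measure Y) (F : Y → ℝ≥0∞) :
    ℝ → ℝ≥0∞ :=
  fun t => μ {y | ENNReal.ofReal t < F y}

/-- The generalized inverse `x ↦ sup {t > 0 | x < d t}` of a function `d : (0, ∞) → [0, ∞]`,
where `sup ∅ = 0`. Only the values of `d` on `(0, ∞)` are used, and only the values of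
the result on `(0, ∞)` are meaningful. -/
noncomputable def generalizedInverse (d : ℝ → ℝ≥0∞) : ℝ → ℝ≥0∞ :=
  fun x => ⨆ (t : ℝ) (_ : 0 < t ∧ ENNReal.ofReal x < d t), ENNReal.ofReal t

/-- The non-increasing rearrangement `F^*` of a `[0, ∞]`-valued function. -/
noncomputable def rearrangement {Y : Type*} [MeasurableSpace Y] (μ : Measure Y)
    (F : Y → ℝ≥0∞) : ℝ → ℝ≥0∞ :=
  generalizedInverse (distributionFunction μ F)

/-- Lebesgue measure on `(0, ∞)`, as a measure on `ℝ` that vanishes on `(-∞, 0]`. -/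
noncomputable def halfLine : Measure ℝ := volume.restrict (Ioi 0)

/-- The space `L¹ + L^∞` of (classes of) complex-valued functions. -/
noncomputable def L1AddLinf {X : Type*} [MeasurableSpace X] (μ : Measure X) :
    Submodule ℂ (X →ₘ[μ] ℂ) :=
  Lp.LpSubmodule ℂ ℂ 1 μ ⊔ Lp.LpSubmodule ℂ ℂ ∞ μ

/-- `∫_0^a f` for `a ∈ [0, ∞]`. -/
noncomputable def integralUpTo (f : ℝ → ℂ) (a : ℝ≥0∞) : ℂ :=
  ∫ t in {t : ℝ | 0 < t ∧ ENNReal.ofReal t < a}, f t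

/-- The normal form Hardy operator `H_b f (x) = ∫_0^{b(x)} f`. -/
noncomputable def normalFormHardy (b : ℝ → ℝ≥0∞) (f : ℝ → ℂ) : ℝ → ℂ :=
  fun x => integralUpTo f (b x)

/-- The intermediate operator `J_B f (y) = ∫_0^{lam (B y)} f`. -/
noncomputable def intermediateHardy {S Y : Type*} [MeasurableSpace S] (lam : Measure S)
    (B : Y → Set S) (f : ℝ → ℂ) : Y → ℂ :=
  fun y => integralUpTo f (lam (B y))

section Admissible

variable {X Y : Type*} [MeasurableSpace X] [MeasurableSpace Y] {ρ : Measure X} {μ : Measure Y}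

/-- The norm in `[0, ∞]` of the restriction of a linear map `T` to a map `L^p → L^p`
(for `p = 1, ∞`): the smallest `C` with `‖T h‖_p ≤ C ‖h‖_p` for all `h ∈ L^p`; the restriction is
bounded exactly when this is finite. -/
noncomputable def restrictionNorm (p : ℝ≥0∞) (T : L1AddLinf ρ →ₗ[ℂ] L1AddLinf μ) : ℝ≥0∞ :=
  sInf {C : ℝ≥0∞ | ∀ h : L1AddLinf ρ, (h : X →ₘ[ρ] ℂ) ∈ Lp ℂ p ρ →
    eLpNorm (T h : Y →ₘ[μ] ℂ) p μ ≤ C * eLpNorm (h : X →ₘ[ρ] ℂ) p ρ}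

/-- `T` is admissible: its restrictions to `L¹ → L¹` and `L^∞ → L^∞` are bounded. -/
def IsAdmissible (T : L1AddLinf ρ →ₗ[ℂ] L1AddLinf μ) : Prop :=
  restrictionNorm 1 T < ∞ ∧ restrictionNorm ∞ T < ∞

/-- The norm of an admissible map. -/
noncomputable def admissibleNorm (T : L1AddLinf ρ →ₗ[ℂ] L1AddLinf μ) : ℝ≥0∞ :=
  max (restrictionNorm 1 T) (restrictionNorm ∞ T)

/-- `T` maps non-negative functions to non-negative functions. -/
def IsPositiveMap (T : L1AddLinf ρ →ₗ[ℂ] L1AddLinf μ) : Prop :=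
  ∀ h : L1AddLinf ρ,
    (∀ᵐ x ∂ρ, 0 ≤ ((h : X →ₘ[ρ] ℂ) x).re ∧ ((h : X →ₘ[ρ] ℂ) x).im = 0) →
    ∀ᵐ y ∂μ, 0 ≤ ((T h : Y →ₘ[μ] ℂ) y).re ∧ ((T h : Y →ₘ[μ] ℂ) y).im = 0

/-- `T`, extended by truncation, takes the function `h` to the function `g`: the truncations
`h · 1_{|h| ≤ n}` belong to `L¹ + L^∞`, and their images under `T` converge to `g` almost
everywhere. -/
def ExtendedMapsTo (T : L1AddLinf ρ →ₗ[ℂ] L1AddLinf μ) (h : X → ℂ) (g : Y → ℂ) : Prop :=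
  ∃ u : ℕ → L1AddLinf ρ,
    (∀ n : ℕ, (u n : X →ₘ[ρ] ℂ) =ᵐ[ρ] {x | ‖h x‖ ≤ (n : ℝ)}.indicator h) ∧
    ∀ᵐ y ∂μ, Tendsto (fun n => (T (u n) : Y →ₘ[μ] ℂ) y) atTop (𝓝 (g y))

end Admissible

/-!
Put `F(y) = λ(B(y))`, so that `b = F^*`. Both Hardy operators are compositions with the single
function `g(a) = ∫_0^a f`, namely `H_b f = g ∘ b` and `J_B f = g ∘ F`, and `g(0) = 0`. It
therefore suffices to have a positive contraction `Φ` with `Φ (g ∘ b) = g ∘ F` for all `g`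
vanishing at `0` with `g ∘ b ∈ L¹ + L^∞`; the truncations of `g ∘ b` are again of this form.

The functions `b` and `F` are equimeasurable (`map_rearrangement_Ioi`), and since `b → 0` at
infinity their common distribution is finite on each `(a, ∞]` with `a > 0`. So Lebesgue measure on
`{b > 0}` and `μ` on `{F > 0}` have the same σ-finite image `ν` on `(0, ∞]`. Disintegrating Lebesgue
measure along `b` gives probability measures `κ_t`, carried by the level sets `{b = t}`, whose
`ν`-average is Lebesgue measure on `{b > 0}` (`exists_markovKernel_disintegration`). The operator is
`Φ h (y) = ∫ h dκ_{F(y)}` where `F(y) > 0`, and `Φ h (y) = 0` elsewhere: it takes the conditional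
expectation of `h` given `b` and transports it from `b` to `F`. It is a contraction of `L^∞` because
the measures `κ_t` have mass one, a contraction of `L¹` because the `μ`-average of the measures
`κ_{F(y)}` is at most Lebesgue measure, and `Φ (g ∘ b) = g ∘ F` because `b = F(y)` almost everywhere
for `κ_{F(y)}` (`kernelOperator_comp`).
-/

open ProbabilityTheory

/-! ### Disintegration along a map -/

/-- Disintegration of a measure `σ` along a map `b` whose image measure is only σ-finite.
Multiplying `σ` by an integrable weight that is a function of `b` makes it finite without changing
the conditional measures, so the disintegration of finite measures on `T × X` applies to the graph
of `b`. -/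
theorem exists_markovKernel_disintegration {X T : Type*} [MeasurableSpace X]
    [StandardBorelSpace X] [Nonempty X] [MeasurableSpace T] (σ : Measure X) {b : X → T}
    (hb : Measurable b) [SigmaFinite (σ.map b)] :
    ∃ κ : Kernel T X, IsMarkovKernel κ ∧ ∀ φ : T × X → ℝ≥0∞, Measurable φ →
      ∫⁻ x, φ (b x, x) ∂σ = ∫⁻ t, ∫⁻ x, φ (t, x) ∂κ t ∂σ.map b := by
  obtain ⟨w, hw_pos, hw, hw_lt⟩ :=
    exists_pos_lintegral_lt_of_sigmaFinite (σ.map b) one_ne_zero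
  have hwm : Measurable fun t => (w t : ℝ≥0∞) := hw.coe_nnreal_ennreal
  have hw0 : ∀ t, (w t : ℝ≥0∞) ≠ 0 := fun t => by simpa using (hw_pos t).ne'
  rw [lintegral_map hwm hb] at hw_lt
  have hwb : Measurable fun x => (w (b x) : ℝ≥0∞) := hwm.comp hb
  have hgraph : Measurable fun x => (b x, x) := hb.prodMk measurable_id
  have : IsFiniteMeasure (σ.withDensity fun x => (w (b x) : ℝ≥0∞)) :=
    isFiniteMeasure_withDensity (hw_lt.trans ENNReal.one_lt_top).ne
  set P : Measure (T × X) :=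
    (σ.withDensity fun x => (w (b x) : ℝ≥0∞)).map fun x => (b x, x) with hP
  have hfst : P.fst = (σ.withDensity fun x => (w (b x) : ℝ≥0∞)).map b := by
    rw [hP, Measure.fst, Measure.map_map measurable_fst hgraph]; rfl
  refine ⟨P.condKernel, inferInstance, fun φ hφ => ?_⟩
  have hq : Measurable fun p : T × X => (w p.1 : ℝ≥0∞)⁻¹ * φ p :=
    (hwm.comp measurable_fst).inv.mul hφ
  have hinner : Measurable fun t => ∫⁻ x, φ (t, x) ∂P.condKernel t :=
    hφ.lintegral_kernel_prod_right'
  calc ∫⁻ x, φ (b x, x) ∂σ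
      = ∫⁻ x, w (b x) * ((w (b x) : ℝ≥0∞)⁻¹ * φ (b x, x)) ∂σ := by
        refine lintegral_congr fun x => ?_
        rw [← mul_assoc, ENNReal.mul_inv_cancel (hw0 _) ENNReal.coe_ne_top, one_mul]
    _ = ∫⁻ p, (w p.1 : ℝ≥0∞)⁻¹ * φ p ∂P := by
        rw [hP, lintegral_map hq hgraph]
        exact (lintegral_withDensity_eq_lintegral_mul _ hwb (hq.comp hgraph)).symm
    _ = ∫⁻ t, ∫⁻ x, (w t : ℝ≥0∞)⁻¹ * φ (t, x) ∂P.condKernel t ∂P.fst := by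
        conv_lhs => rw [← P.disintegrate P.condKernel]
        rw [Measure.lintegral_compProd hq]
    _ = ∫⁻ t, (w t : ℝ≥0∞)⁻¹ * ∫⁻ x, φ (t, x) ∂P.condKernel t ∂P.fst := by
        refine lintegral_congr fun t => ?_
        exact lintegral_const_mul _ (hφ.comp measurable_prodMk_left)
    _ = ∫⁻ x, w (b x) * ((w (b x) : ℝ≥0∞)⁻¹ * ∫⁻ x', φ (b x, x') ∂P.condKernel (b x)) ∂σ := by
        rw [hfst]
        exact (lintegral_map (hwm.inv.mul hinner) hb).trans
          (lintegral_withDensity_eq_lintegral_mul _ hwb ((hwm.inv.mul hinner).comp hb))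
    _ = ∫⁻ x, ∫⁻ x', φ (b x, x') ∂P.condKernel (b x) ∂σ := by
        refine lintegral_congr fun x => ?_
        rw [← mul_assoc, ENNReal.mul_inv_cancel (hw0 _) ENNReal.coe_ne_top, one_mul]
    _ = ∫⁻ t, ∫⁻ x, φ (t, x) ∂P.condKernel t ∂σ.map b := (lintegral_map hinner hb).symm

/-- If `b` and `F` have the same image measure on `A`, there is a kernel `η` from `Y` to `X` with
`μ.bind η ≤ ρ` whose value at almost every `y` with `F y ∈ A` is a probability measure carried by
the level set `b = F y`: the conditional measure of `ρ` given `b`, evaluated at `F y`. Off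
`F ⁻¹' A` the kernel is zero. -/
theorem exists_subMarkovKernel_of_map_restrict_eq {X Y T : Type*} [MeasurableSpace X]
    [StandardBorelSpace X] [Nonempty X] [MeasurableSpace Y] [MeasurableSpace T] [MeasurableEq T]
    {ρ : Measure X} {μ : Measure Y} {b : X → T} {F : Y → T} (hb : Measurable b)
    (hF : Measurable F) {A : Set T} (hA : MeasurableSet A)
    (h : (ρ.map b).restrict A = (μ.map F).restrict A)
    [SigmaFinite ((ρ.map b).restrict A)] :
    ∃ η : Kernel Y X, (∀ y, η y univ ≤ 1) ∧ μ.bind η ≤ ρ ∧ (∀ y, F y ∉ A → η y = 0) ∧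
      ∀ᵐ y ∂μ, F y ∈ A → η y univ = 1 ∧ ∀ᵐ x ∂η y, b x = F y := by
  rw [Measure.restrict_map hb hA, Measure.restrict_map hF hA] at h
  have hsf : SigmaFinite ((ρ.restrict (b ⁻¹' A)).map b) := by
    rw [← Measure.restrict_map hb hA]; infer_instance
  obtain ⟨κ, hκ, hdis⟩ := exists_markovKernel_disintegration (ρ.restrict (b ⁻¹' A)) hb
  classical
  have hFA : MeasurableSet (F ⁻¹' A) := hF hA
  refine ⟨Kernel.piecewise hFA (κ.comap F hF) 0, fun y => ?_, ?_, fun y hy => ?_, ?_⟩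
  · rw [Kernel.piecewise_apply]
    split_ifs <;> simp
  · refine Measure.le_iff.2 fun s hs => ?_
    have hind : ∀ y, Kernel.piecewise hFA (κ.comap F hF) 0 y s
        = (F ⁻¹' A).indicator (fun y => κ (F y) s) y := fun y => by
      rw [Kernel.piecewise_apply']
      by_cases hy : y ∈ F ⁻¹' A <;> simp [hy, Kernel.comap_apply]
    rw [Measure.bind_apply hs (Kernel.aemeasurable _), lintegral_congr hind,
      lintegral_indicator hFA, ← lintegral_map (κ.measurable_coe hs) hF, ← h]
    have := hdis (fun p => s.indicator 1 p.2)
      ((measurable_one.indicator hs).comp measurable_snd)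
    simp only [lintegral_indicator_one hs] at this
    rw [← this]
    exact Measure.restrict_apply_le _ _
  · rw [Kernel.piecewise_apply, if_neg (show y ∉ F ⁻¹' A from hy)]; rfl
  -- The indicator of `{(t, x) | b x ≠ t}` vanishes on the graph of `b`, so by the disintegration it
  -- has zero integral against almost every conditional measure.
  · have hne : MeasurableSet {p : T × X | b p.2 ≠ p.1} :=
      (measurableSet_eq_fun (hb.comp measurable_snd) measurable_fst).compl
    have := hdis ({p : T × X | b p.2 ≠ p.1}.indicator 1) (measurable_one.indicator hne)
    have h0 : ∀ᵐ t ∂((ρ.restrict (b ⁻¹' A)).map b), ∀ᵐ x ∂κ t, b x = t := by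
      have hm : Measurable fun t =>
          ∫⁻ x, {p : T × X | b p.2 ≠ p.1}.indicator (1 : T × X → ℝ≥0∞) (t, x) ∂κ t :=
        (measurable_one.indicator hne).lintegral_kernel_prod_right'
      have h1 : ∫⁻ x, {p : T × X | b p.2 ≠ p.1}.indicator (1 : T × X → ℝ≥0∞) (b x, x)
          ∂(ρ.restrict (b ⁻¹' A)) = 0 := by simp
      rw [h1, eq_comm, lintegral_eq_zero_iff hm] at this
      filter_upwards [this] with t ht
      have hmt : Measurable fun x =>
          {p : T × X | b p.2 ≠ p.1}.indicator (1 : T × X → ℝ≥0∞) (t, x) :=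
        (measurable_one.indicator hne).comp measurable_prodMk_left
      rw [Pi.zero_apply, lintegral_eq_zero_iff hmt] at ht
      filter_upwards [ht] with x hx
      by_contra hxt
      simp [indicator_of_mem (show (t, x) ∈ {p : T × X | b p.2 ≠ p.1} from hxt)] at hx
    rw [h] at h0
    have h2 := (ae_restrict_iff' hFA).1 (ae_of_ae_map hF.aemeasurable h0)
    filter_upwards [h2] with y hy hyA
    rw [Kernel.piecewise_apply, if_pos (show y ∈ F ⁻¹' A from hyA), Kernel.comap_apply]
    exact ⟨measure_univ, hy hyA⟩

/-! ### The rearrangement and its distribution -/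

section Rearrangement

variable {Y : Type*} [MeasurableSpace Y] {μ : Measure Y} {F : Y → ℝ≥0∞}

theorem distributionFunction_antitone : Antitone (distributionFunction μ F) := fun _ _ hst =>
  measure_mono fun _ hy => (ENNReal.ofReal_le_ofReal hst).trans_lt hy

/-- Right continuity of the distribution function, along the sequence `t + 1 / (n + 1)`. -/
theorem distributionFunction_eq_iSup (t : ℝ) :
    distributionFunction μ F t = ⨆ n : ℕ, distributionFunction μ F (t + 1 / (n + 1)) := by
  have hmono : Monotone fun n : ℕ => {y | ENNReal.ofReal (t + 1 / ((n : ℝ) + 1)) < F y} :=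
    fun m n hmn y hy => (ENNReal.ofReal_le_ofReal
      (by gcongr)).trans_lt hy
  have hlim : Tendsto (fun n : ℕ => ENNReal.ofReal (t + 1 / ((n : ℝ) + 1))) atTop
      (𝓝 (ENNReal.ofReal t)) := by
    have := (tendsto_one_div_add_atTop_nhds_zero_nat (𝕜 := ℝ)).const_add t
    rw [add_zero] at this
    exact (ENNReal.continuous_ofReal.tendsto t).comp this
  have hU : {y | ENNReal.ofReal t < F y}
      = ⋃ n : ℕ, {y | ENNReal.ofReal (t + 1 / ((n : ℝ) + 1)) < F y} := by
    ext y
    simp only [mem_ofPred_eq, mem_iUnion]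
    refine ⟨fun hy => (hlim.eventually_lt_const hy).exists, fun ⟨n, hn⟩ => ?_⟩
    exact (ENNReal.ofReal_le_ofReal (by simp; positivity)).trans_lt hn
  simp only [distributionFunction]
  rw [hU, hmono.measure_iUnion]

/-- The Galois-type relation `t < F^*(x) ↔ x < μ {F > t}`; the direction from right to left is the
right continuity of the distribution function. -/
theorem ofReal_lt_rearrangement_iff {t : ℝ} (ht : 0 ≤ t) (x : ℝ) :
    ENNReal.ofReal t < rearrangement μ F x ↔ ENNReal.ofReal x < distributionFunction μ F t := by
  constructor
  · intro h
    obtain ⟨s, hs⟩ := lt_iSup_iff.1 h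
    obtain ⟨⟨-, hxs⟩, hts⟩ := lt_iSup_iff.1 hs
    exact hxs.trans_le
      (distributionFunction_antitone ((ENNReal.ofReal_lt_ofReal_iff_of_nonneg ht).1 hts).le)
  · intro h
    rw [distributionFunction_eq_iSup] at h
    obtain ⟨n, hn⟩ := lt_iSup_iff.1 h
    have hpos : (0 : ℝ) < 1 / ((n : ℝ) + 1) := by positivity
    refine ((ENNReal.ofReal_lt_ofReal_iff_of_nonneg ht).2 (lt_add_of_pos_right t hpos)).trans_le ?_
    exact le_iSup₂ (f := fun (t : ℝ) (_ : 0 < t ∧ ENNReal.ofReal x < distributionFunction μ F t) =>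
      ENNReal.ofReal t) _ ⟨by linarith, hn⟩

theorem rearrangement_antitone : Antitone (rearrangement μ F) := fun _ _ hxy =>
  iSup_mono fun _ => iSup_mono' fun h =>
    ⟨⟨h.1, (ENNReal.ofReal_le_ofReal hxy).trans_lt h.2⟩, le_rfl⟩

/-- This is where the decay of the rearrangement is used: it makes the common distribution of
`F` and `F^*` σ-finite on `(0, ∞]`. -/
theorem distributionFunction_lt_top_of_tendsto
    (h : Tendsto (rearrangement μ F) atTop (𝓝 0)) {t : ℝ} (ht : 0 < t) :
    distributionFunction μ F t < ∞ := by
  obtain ⟨x, hx⟩ := (h.eventually_lt_const (ENNReal.ofReal_pos.2 ht)).exists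
  by_contra htop
  refine hx.not_gt ((ofReal_lt_rearrangement_iff ht.le x).2 ?_)
  exact ENNReal.ofReal_lt_top.trans_le (not_lt.1 htop)

theorem rearrangement_congr_ae {G : Y → ℝ≥0∞} (h : F =ᵐ[μ] G) :
    rearrangement μ F = rearrangement μ G := by
  have : distributionFunction μ F = distributionFunction μ G := by
    funext t
    refine measure_congr ?_
    filter_upwards [h] with y hy
    exact congrArg (ENNReal.ofReal t < ·) hy
  rw [rearrangement, rearrangement, this]

theorem halfLine_ofReal_lt (a : ℝ≥0∞) : halfLine {x | ENNReal.ofReal x < a} = a := by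
  have hset : {x : ℝ | ENNReal.ofReal x < a} ∩ Ioi 0 = {x | 0 < x ∧ ENNReal.ofReal x < a} := by
    ext x; exact and_comm
  have hm : MeasurableSet {x : ℝ | ENNReal.ofReal x < a} :=
    measurableSet_lt ENNReal.measurable_ofReal measurable_const
  rw [halfLine, Measure.restrict_apply hm, hset]
  rcases eq_or_ne a ∞ with rfl | ha
  · have : {x : ℝ | 0 < x ∧ ENNReal.ofReal x < ∞} = Ioi 0 := by ext x; simp
    rw [this, Real.volume_Ioi]
  · have : {x : ℝ | 0 < x ∧ ENNReal.ofReal x < a} = Ioo 0 a.toReal := by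
      ext x
      simp only [mem_ofPred_eq, mem_Ioo]
      exact and_congr_right fun hx => ENNReal.ofReal_lt_iff_lt_toReal hx.le ha
    rw [this, Real.volume_Ioo, sub_zero, ENNReal.ofReal_toReal ha]

/-- Equimeasurability: `F^*` and `F` have the same distribution function. -/
theorem map_rearrangement_Ioi (hF : Measurable F) (a : ℝ≥0∞) :
    halfLine.map (rearrangement μ F) (Ioi a) = μ.map F (Ioi a) := by
  rw [Measure.map_apply rearrangement_antitone.measurable measurableSet_Ioi,
    Measure.map_apply hF measurableSet_Ioi]
  rcases eq_or_ne a ∞ with rfl | ha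
  · simp
  · rw [← ENNReal.ofReal_toReal ha]
    have : rearrangement μ F ⁻¹' Ioi (ENNReal.ofReal a.toReal)
        = {x | ENNReal.ofReal x < distributionFunction μ F a.toReal} := by
      ext x
      exact ofReal_lt_rearrangement_iff ENNReal.toReal_nonneg x
    rw [this, halfLine_ofReal_lt]
    rfl

end Rearrangement

theorem Ioi_zero_eq_iUnion_Ioi_inv : Ioi (0 : ℝ≥0∞) = ⋃ n : ℕ, Ioi ((n : ℝ≥0∞) + 1)⁻¹ := by
  ext t
  simp only [mem_Ioi, mem_iUnion]
  refine ⟨fun ht => ?_, fun ⟨n, hn⟩ => bot_lt_of_lt hn⟩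
  obtain ⟨n, hn⟩ := ENNReal.exists_inv_nat_lt ht.ne'
  exact ⟨n, (ENNReal.inv_le_inv.2 le_self_add).trans_lt hn⟩

theorem inv_natCast_add_one_ne_zero (n : ℕ) : ((n : ℝ≥0∞) + 1)⁻¹ ≠ 0 :=
  ENNReal.inv_ne_zero.2 (ENNReal.add_ne_top.2 ⟨ENNReal.natCast_ne_top n, ENNReal.one_ne_top⟩)

/-- Measures on `(0, ∞]` with the same distribution function, finite at each `a ≠ 0`, are equal.
Their masses at `0` may differ, and may be infinite. -/
theorem restrict_Ioi_zero_eq_of_measure_Ioi_eq {ν ν' : Measure ℝ≥0∞}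
    (h : ∀ a, ν (Ioi a) = ν' (Ioi a)) (hfin : ∀ a, a ≠ 0 → ν (Ioi a) ≠ ∞) :
    ν.restrict (Ioi 0) = ν'.restrict (Ioi 0) := by
  rw [Ioi_zero_eq_iUnion_Ioi_inv, Measure.restrict_iUnion_congr]
  intro n
  have hε := inv_natCast_add_one_ne_zero n
  generalize ((n : ℝ≥0∞) + 1)⁻¹ = ε at hε
  have : IsFiniteMeasure (ν.restrict (Ioi ε)) := ⟨by simpa using (hfin ε hε).lt_top⟩
  refine Measure.ext_of_Iic _ _ fun a => ?_
  have hset : Iic a ∩ Ioi ε = Ioi ε \ Ioi (max ε a) := by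
    ext t
    simp only [mem_inter_iff, mem_Iic, mem_Ioi, Set.mem_sdiff, max_lt_iff, not_and, not_lt]
    exact ⟨fun h => ⟨h.2, fun _ => h.1⟩, fun h => ⟨h.2 h.1, h.1⟩⟩
  have hsub : Ioi (max ε a) ⊆ Ioi ε := Ioi_subset_Ioi (le_max_left _ _)
  have hfin' : ν (Ioi (max ε a)) ≠ ∞ := ((measure_mono hsub).trans_lt (hfin ε hε).lt_top).ne
  rw [Measure.restrict_apply measurableSet_Iic, Measure.restrict_apply measurableSet_Iic, hset,
    measure_sdiff hsub measurableSet_Ioi.nullMeasurableSet hfin',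
    measure_sdiff hsub measurableSet_Ioi.nullMeasurableSet (h _ ▸ hfin'), h, h]

theorem sigmaFinite_restrict_Ioi_zero {ν : Measure ℝ≥0∞}
    (hfin : ∀ a, a ≠ 0 → ν (Ioi a) ≠ ∞) : SigmaFinite (ν.restrict (Ioi 0)) := by
  refine ⟨⟨⟨fun n : ℕ => Iic 0 ∪ Ioi ((n : ℝ≥0∞) + 1)⁻¹, fun _ => trivial, fun n => ?_, ?_⟩⟩⟩
  · rw [Measure.restrict_apply' measurableSet_Ioi, union_inter_distrib_right, Iic_inter_Ioi,
      Ioc_self, empty_union]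
    exact (measure_mono inter_subset_left).trans_lt
      (hfin _ (inv_natCast_add_one_ne_zero n)).lt_top
  · rw [← union_iUnion, ← Ioi_zero_eq_iUnion_Ioi_inv, Iic_union_Ioi]

/-! ### Averaging operators on `L¹ + L^∞` -/

section KernelOperator

variable {X Y : Type*} [MeasurableSpace X] [MeasurableSpace Y] {ρ : Measure X} {μ : Measure Y}
  {η : Kernel Y X}

theorem ae_ae_kernel_of_ae (hle : μ.bind η ≤ ρ) {p : X → Prop} (h : ∀ᵐ x ∂ρ, p x) :
    ∀ᵐ y ∂μ, ∀ᵐ x ∂η y, p x :=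
  Measure.ae_ae_of_ae_bind η.aemeasurable (ae_mono hle h)

variable (μ η) in
/-- The class of the averages `y ↦ ∫ h dη_y` of the chosen representative of `h`. When
`μ.bind η ≤ ρ`, another representative gives the same class, by `ae_ae_kernel_of_ae`. -/
noncomputable def kernelAverage (h : X →ₘ[ρ] ℂ) : Y →ₘ[μ] ℂ :=
  AEEqFun.mk (fun y => ∫ x, h x ∂η y) h.stronglyMeasurable.integral_kernel.aestronglyMeasurable

theorem coeFn_kernelAverage (h : X →ₘ[ρ] ℂ) :
    kernelAverage μ η h =ᵐ[μ] fun y => ∫ x, h x ∂η y :=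
  AEEqFun.coeFn_mk _ _

theorem lintegral_enorm_kernel_le (hle : μ.bind η ≤ ρ) (h : X →ₘ[ρ] ℂ) :
    ∫⁻ y, ∫⁻ x, ‖h x‖ₑ ∂η y ∂μ ≤ eLpNorm h 1 ρ := by
  rw [← Measure.lintegral_bind η.aemeasurable h.stronglyMeasurable.measurable.enorm.aemeasurable,
    eLpNorm_one_eq_lintegral_enorm]
  exact lintegral_mono' hle le_rfl

theorem eLpNorm_one_kernelAverage_le (hle : μ.bind η ≤ ρ) (h : X →ₘ[ρ] ℂ) :
    eLpNorm (kernelAverage μ η h) 1 μ ≤ eLpNorm h 1 ρ := by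
  rw [eLpNorm_congr_ae (coeFn_kernelAverage h), eLpNorm_one_eq_lintegral_enorm]
  exact (lintegral_mono fun y => enorm_integral_le_lintegral_enorm _).trans
    (lintegral_enorm_kernel_le hle h)

theorem eLpNorm_top_kernelAverage_le (hη : ∀ y, η y univ ≤ 1) (hle : μ.bind η ≤ ρ)
    (h : X →ₘ[ρ] ℂ) : eLpNorm (kernelAverage μ η h) ∞ μ ≤ eLpNorm h ∞ ρ := by
  rw [eLpNorm_congr_ae (coeFn_kernelAverage h), eLpNorm_exponent_top, eLpNorm_exponent_top]
  refine eLpNormEssSup_le_of_ae_enorm_bound ?_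
  filter_upwards [ae_ae_kernel_of_ae hle (ae_le_eLpNormEssSup (f := h) (μ := ρ))] with y hy
  calc ‖∫ x, h x ∂η y‖ₑ ≤ ∫⁻ x, ‖h x‖ₑ ∂η y := enorm_integral_le_lintegral_enorm _
    _ ≤ ∫⁻ _, eLpNormEssSup h ρ ∂η y := lintegral_mono_ae hy
    _ ≤ eLpNormEssSup h ρ := by
      rw [lintegral_const]; exact mul_le_of_le_one_right' (hη y)

theorem ae_integrable_kernel (hη : ∀ y, η y univ ≤ 1) (hle : μ.bind η ≤ ρ) {h : X →ₘ[ρ] ℂ}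
    (hh : h ∈ L1AddLinf ρ) : ∀ᵐ y ∂μ, Integrable h (η y) := by
  obtain ⟨f, hf, g, hg, rfl⟩ := Submodule.mem_sup.1 hh
  have hf1 : eLpNorm f 1 ρ < ∞ := Lp.mem_Lp_iff_eLpNorm_lt_top.1 hf
  have hg1 : eLpNorm g ∞ ρ < ∞ := Lp.mem_Lp_iff_eLpNorm_lt_top.1 hg
  have hfin := ae_lt_top' (f.stronglyMeasurable.measurable.enorm.lintegral_kernel
    (κ := η)).aemeasurable ((lintegral_enorm_kernel_le hle f).trans_lt hf1).ne
  filter_upwards [hfin, ae_ae_kernel_of_ae hle (ae_le_eLpNormEssSup (f := g) (μ := ρ)),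
    ae_ae_kernel_of_ae hle (AEEqFun.coeFn_add f g)] with y hfy hgy hadd
  refine (Integrable.add ⟨f.stronglyMeasurable.aestronglyMeasurable, hfy⟩
    ⟨g.stronglyMeasurable.aestronglyMeasurable, ?_⟩).congr (EventuallyEq.symm hadd)
  refine (lintegral_mono_ae hgy).trans_lt ?_
  rw [lintegral_const]
  exact (mul_le_of_le_one_right' (hη y)).trans_lt (by rwa [← eLpNorm_exponent_top])

theorem kernelAverage_add (hη : ∀ y, η y univ ≤ 1) (hle : μ.bind η ≤ ρ) {f g : X →ₘ[ρ] ℂ}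
    (hf : f ∈ L1AddLinf ρ) (hg : g ∈ L1AddLinf ρ) :
    kernelAverage μ η (f + g) = kernelAverage μ η f + kernelAverage μ η g := by
  refine AEEqFun.ext ?_
  filter_upwards [coeFn_kernelAverage (μ := μ) (η := η) (f + g),
    coeFn_kernelAverage (μ := μ) (η := η) f, coeFn_kernelAverage (μ := μ) (η := η) g,
    AEEqFun.coeFn_add (kernelAverage μ η f) (kernelAverage μ η g),
    ae_ae_kernel_of_ae hle (AEEqFun.coeFn_add f g), ae_integrable_kernel hη hle hf,
    ae_integrable_kernel hη hle hg] with y h1 h2 h3 h4 h5 h6 h7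
  rw [h1, h4, Pi.add_apply, h2, h3, ← integral_add h6 h7]
  exact integral_congr_ae h5

theorem kernelAverage_smul (hle : μ.bind η ≤ ρ) (c : ℂ) (f : X →ₘ[ρ] ℂ) :
    kernelAverage μ η (c • f) = c • kernelAverage μ η f := by
  refine AEEqFun.ext ?_
  filter_upwards [coeFn_kernelAverage (μ := μ) (η := η) (c • f),
    coeFn_kernelAverage (μ := μ) (η := η) f, AEEqFun.coeFn_smul c (kernelAverage μ η f),
    ae_ae_kernel_of_ae hle (AEEqFun.coeFn_smul c f)] with y h1 h2 h3 h4
  rw [h1, h3, Pi.smul_apply, h2, ← integral_smul]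
  exact integral_congr_ae h4

theorem kernelAverage_mem (hη : ∀ y, η y univ ≤ 1) (hle : μ.bind η ≤ ρ) {h : X →ₘ[ρ] ℂ}
    (hh : h ∈ L1AddLinf ρ) : kernelAverage μ η h ∈ L1AddLinf μ := by
  obtain ⟨f, hf, g, hg, rfl⟩ := Submodule.mem_sup.1 hh
  rw [kernelAverage_add hη hle (Submodule.mem_sup_left hf) (Submodule.mem_sup_right hg)]
  exact Submodule.add_mem_sup
    (Lp.mem_Lp_iff_eLpNorm_lt_top.2 ((eLpNorm_one_kernelAverage_le hle f).trans_lt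
      (Lp.mem_Lp_iff_eLpNorm_lt_top.1 hf)))
    (Lp.mem_Lp_iff_eLpNorm_lt_top.2 ((eLpNorm_top_kernelAverage_le hη hle g).trans_lt
      (Lp.mem_Lp_iff_eLpNorm_lt_top.1 hg)))

/-- Averaging against a sub-Markov kernel `η` with `μ.bind η ≤ ρ`, as a linear map from `L¹ + L^∞`
to `L¹ + L^∞`. The first hypothesis makes it a contraction of `L^∞`, the second one of `L¹`. -/
noncomputable def kernelOperator (hη : ∀ y, η y univ ≤ 1) (hle : μ.bind η ≤ ρ) :
    L1AddLinf ρ →ₗ[ℂ] L1AddLinf μ where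
  toFun h := ⟨kernelAverage μ η h, kernelAverage_mem hη hle h.2⟩
  map_add' f g := Subtype.ext (kernelAverage_add hη hle f.2 g.2)
  map_smul' c f := Subtype.ext (kernelAverage_smul hle c f)

variable (hη : ∀ y, η y univ ≤ 1) (hle : μ.bind η ≤ ρ)

theorem isPositiveMap_kernelOperator : IsPositiveMap (kernelOperator hη hle) := by
  intro h hh
  filter_upwards [coeFn_kernelAverage (μ := μ) (η := η) (h : X →ₘ[ρ] ℂ),
    ae_ae_kernel_of_ae hle hh] with y hy hpos
  have hreal : ∫ x, (h : X →ₘ[ρ] ℂ) x ∂η y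
      = ((∫ x, ((h : X →ₘ[ρ] ℂ) x).re ∂η y : ℝ) : ℂ) := by
    rw [← integral_complex_ofReal]
    exact integral_congr_ae (hpos.mono fun x hx => Complex.ext rfl hx.2)
  change 0 ≤ (kernelAverage μ η (h : X →ₘ[ρ] ℂ) y).re ∧
    (kernelAverage μ η (h : X →ₘ[ρ] ℂ) y).im = 0
  rw [hy, hreal]
  exact ⟨integral_nonneg_of_ae (hpos.mono fun x hx => hx.1), Complex.ofReal_im _⟩

theorem restrictionNorm_one_kernelOperator_le :
    restrictionNorm 1 (kernelOperator hη hle) ≤ 1 :=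
  sInf_le fun h _ => by rw [one_mul]; exact eLpNorm_one_kernelAverage_le hle h

theorem restrictionNorm_top_kernelOperator_le :
    restrictionNorm ∞ (kernelOperator hη hle) ≤ 1 :=
  sInf_le fun h _ => by rw [one_mul]; exact eLpNorm_top_kernelAverage_le hη hle h

/-- If `η y` is a probability measure on the level set `b = F y` when `F y ∈ A` and zero otherwise,
the averaging operator takes `g ∘ b` to `g ∘ F`, for each `g` that vanishes off `A`. -/
theorem kernelOperator_comp {T : Type*} {b : X → T} {F : Y → T} {A : Set T}
    (h0 : ∀ y, F y ∉ A → η y = 0)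
    (h1 : ∀ᵐ y ∂μ, F y ∈ A → η y univ = 1 ∧ ∀ᵐ x ∂η y, b x = F y)
    {g : T → ℂ} (hg : ∀ t, t ∉ A → g t = 0) {h : L1AddLinf ρ}
    (hh : (h : X →ₘ[ρ] ℂ) =ᵐ[ρ] g ∘ b) :
    (kernelOperator hη hle h : Y →ₘ[μ] ℂ) =ᵐ[μ] g ∘ F := by
  filter_upwards [coeFn_kernelAverage (μ := μ) (η := η) (h : X →ₘ[ρ] ℂ),
    ae_ae_kernel_of_ae hle hh, h1] with y hy hhy h1y
  refine hy.trans ?_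
  by_cases hyA : F y ∈ A
  · obtain ⟨hone, hb⟩ := h1y hyA
    have : ∫ x, (h : X →ₘ[ρ] ℂ) x ∂η y = ∫ _, g (F y) ∂η y := by
      refine integral_congr_ae ?_
      filter_upwards [hhy, hb] with x hx hbx
      rw [hx, Function.comp_apply, hbx]
    rw [this, integral_const, measureReal_def, hone, ENNReal.toReal_one, one_smul,
      Function.comp_apply]
  · rw [h0 y hyA, integral_zero_measure, Function.comp_apply, hg _ hyA]

end KernelOperator

/-! ### The Hardy operators -/

theorem integralUpTo_zero (f : ℝ → ℂ) : integralUpTo f 0 = 0 := by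
  simp [integralUpTo]

/-- No integrability is needed, not even at `a = ∞`: a parametric Bochner integral of a jointly
measurable function is measurable, with the value zero where the integrand is not integrable. -/
theorem stronglyMeasurable_integralUpTo {f : ℝ → ℂ} (hf : StronglyMeasurable f) :
    StronglyMeasurable (integralUpTo f) := by
  have hset : MeasurableSet {p : ℝ≥0∞ × ℝ | 0 < p.2 ∧ ENNReal.ofReal p.2 < p.1} :=
    (measurableSet_lt measurable_const measurable_snd).inter
      (measurableSet_lt (ENNReal.measurable_ofReal.comp measurable_snd) measurable_fst)
  have heq : integralUpTo f = fun a => ∫ t : ℝ,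
      {p : ℝ≥0∞ × ℝ | 0 < p.2 ∧ ENNReal.ofReal p.2 < p.1}.indicator (fun p => f p.2) (a, t) := by
    funext a
    exact (integral_indicator (f := f) (hset.preimage measurable_prodMk_left)).symm
  rw [heq]
  exact ((hf.comp_measurable measurable_snd).indicator hset).integral_prod_right'

theorem exists_truncation {X : Type*} [MeasurableSpace X] {ρ : Measure X} {h : X → ℂ}
    (hh : StronglyMeasurable h) (n : ℕ) :
    ∃ u : L1AddLinf ρ, (u : X →ₘ[ρ] ℂ) =ᵐ[ρ] {x | ‖h x‖ ≤ (n : ℝ)}.indicator h := by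
  have hs : MeasurableSet {x | ‖h x‖ ≤ (n : ℝ)} :=
    measurableSet_le hh.norm.measurable measurable_const
  have hm : AEStronglyMeasurable ({x | ‖h x‖ ≤ (n : ℝ)}.indicator h) ρ :=
    (hh.indicator hs).aestronglyMeasurable
  have hmem : MemLp ({x | ‖h x‖ ≤ (n : ℝ)}.indicator h) ∞ ρ := by
    refine memLp_top_of_bound hm n (ae_of_all _ fun x => ?_)
    by_cases hx : ‖h x‖ ≤ (n : ℝ)
    · rwa [indicator_of_mem (show x ∈ {x | ‖h x‖ ≤ (n : ℝ)} from hx)]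
    · rw [indicator_of_notMem (show x ∉ {x | ‖h x‖ ≤ (n : ℝ)} from hx), norm_zero]
      exact n.cast_nonneg
  exact ⟨⟨AEEqFun.mk _ hm, Submodule.mem_sup_right (hmem.toLp _).2⟩, AEEqFun.coeFn_mk _ _⟩

theorem theorem5p5 {S Y : Type*} [MeasurableSpace S] [MeasurableSpace Y]
    (lam : Measure S) (μ : Measure Y) [SigmaFinite lam] [SigmaFinite μ]
    (B : Y → Set S) (hB : IsCoreMap lam μ B)
    (b : ℝ → ℝ≥0∞) (hb : b = rearrangement μ (fun y => lam (B y)))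
    (hb0 : Tendsto b atTop (𝓝 0)) :
    ∃ Φ : L1AddLinf halfLine →ₗ[ℂ] L1AddLinf μ,
      IsPositiveMap Φ ∧ IsAdmissible Φ ∧ admissibleNorm Φ ≤ 1 ∧
      (∀ f h : L1AddLinf halfLine,
        (h : ℝ →ₘ[halfLine] ℂ) =ᵐ[halfLine] normalFormHardy b (f : ℝ →ₘ[halfLine] ℂ) →
        (Φ h : Y →ₘ[μ] ℂ) =ᵐ[μ] intermediateHardy lam B (f : ℝ →ₘ[halfLine] ℂ)) ∧
      (∀ f : L1AddLinf halfLine,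
        ExtendedMapsTo Φ (normalFormHardy b (f : ℝ →ₘ[halfLine] ℂ))
          (intermediateHardy lam B (f : ℝ →ₘ[halfLine] ℂ))) := by
  have hFm : AEMeasurable (fun y => lam (B y)) μ := by
    simpa using hB.aemeasurable univ MeasurableSet.univ
  set F : Y → ℝ≥0∞ := hFm.mk
  have hF : Measurable F := hFm.measurable_mk
  have hFB : (fun y => lam (B y)) =ᵐ[μ] F := hFm.ae_eq_mk
  rw [rearrangement_congr_ae hFB] at hb
  subst hb
  have hbm : Measurable (rearrangement μ F) := rearrangement_antitone.measurable
  have hIoi := map_rearrangement_Ioi (μ := μ) hF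
  have hfin : ∀ a, a ≠ 0 → halfLine.map (rearrangement μ F) (Ioi a) ≠ ∞ := by
    intro a ha
    rw [hIoi, Measure.map_apply hF measurableSet_Ioi]
    rcases eq_or_ne a ∞ with rfl | hatop
    · simp
    · have := distributionFunction_lt_top_of_tendsto hb0 (ENNReal.toReal_pos ha hatop)
      rw [distributionFunction, ENNReal.ofReal_toReal hatop] at this
      exact this.ne
  have := sigmaFinite_restrict_Ioi_zero hfin
  obtain ⟨η, hη, hle, hη0, hη1⟩ := exists_subMarkovKernel_of_map_restrict_eq hbm hF
    measurableSet_Ioi (restrict_Ioi_zero_eq_of_measure_Ioi_eq hIoi hfin)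
  have hone := restrictionNorm_one_kernelOperator_le hη hle
  have htop := restrictionNorm_top_kernelOperator_le hη hle
  have hzero : ∀ t : ℝ≥0∞, t ∉ Ioi 0 → t = 0 := fun t ht => by simpa using ht
  have hJ : ∀ f : ℝ → ℂ, intermediateHardy lam B f =ᵐ[μ] integralUpTo f ∘ F := fun f =>
    hFB.mono fun y hy => congrArg (integralUpTo f) hy
  refine ⟨kernelOperator hη hle, isPositiveMap_kernelOperator hη hle,
    ⟨hone.trans_lt ENNReal.one_lt_top, htop.trans_lt ENNReal.one_lt_top⟩, max_le hone htop,
    fun f h hh => ?_, fun f => ?_⟩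
  -- Both Hardy operators are compositions with `a ↦ ∫_0^a f`, which vanishes at `a = 0`.
  · refine EventuallyEq.trans ?_ (hJ _).symm
    exact kernelOperator_comp hη hle hη0 hη1
      (fun t ht => by rw [hzero t ht, integralUpTo_zero]) hh
  · have hg : StronglyMeasurable (integralUpTo (f : ℝ →ₘ[halfLine] ℂ)) :=
      stronglyMeasurable_integralUpTo (f : ℝ →ₘ[halfLine] ℂ).stronglyMeasurable
    have hg0 := integralUpTo_zero (f : ℝ →ₘ[halfLine] ℂ)
    generalize hgdef : integralUpTo (f : ℝ →ₘ[halfLine] ℂ) = g at hg hg0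
    have hH : normalFormHardy (rearrangement μ F) (f : ℝ →ₘ[halfLine] ℂ)
        = g ∘ rearrangement μ F := by rw [← hgdef]; rfl
    have hJf := hJ (f : ℝ →ₘ[halfLine] ℂ)
    rw [hgdef] at hJf
    rw [hH]
    choose u hu using exists_truncation (ρ := halfLine) (hg.comp_measurable hbm)
    refine ⟨u, hu, ?_⟩
    have hcomp : ∀ n : ℕ, (kernelOperator hη hle (u n) : Y →ₘ[μ] ℂ) =ᵐ[μ]
        {t | ‖g t‖ ≤ (n : ℝ)}.indicator g ∘ F := fun n =>
      kernelOperator_comp hη hle hη0 hη1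
        (fun t ht => by rw [hzero t ht]; simp [indicator, hg0]) (hu n)
    filter_upwards [ae_all_iff.2 hcomp, hJf] with y hy hJy
    rw [hJy]
    -- At a fixed `y` the sequence is constant once `n ≥ |g (F y)|`.
    refine tendsto_const_nhds.congr' ?_
    filter_upwards [tendsto_natCast_atTop_atTop.eventually_ge_atTop ‖g (F y)‖] with n hn
    rw [hy n, Function.comp_apply, Function.comp_apply,
      indicator_of_mem (show F y ∈ {t | ‖g t‖ ≤ (n : ℝ)} from hn)]
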